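/- Let $\mathcal Z,\mathcal W$ be measurable spaces, $\mu$ a probability measure on $\mathcal Z$, $\ell:\mathcal W\times\mathcal Z\to\mathbb R$ a measurable loss with $\ell(w,\cdot)$ $\mu$-integrable for every $w$, and $L_\mu(w)=\int\ell(w,z)\,\mu(dz)$. Let $n\ge 1$, $S=(Z_1,\dots,Z_n)\sim\mu^{\otimes n}$, $L_S(w)=\frac1n\sum_{i=1}^n\ell(w,Z_i)$, and let $Z,\tilde Z\sim\mu$. Write $I$ for Shannon mutual information (in nats). For $R\ge 0$ define, with values in $[-\infty,\infty]$, $$\mathcal U_1(R)=\sup_{P_{\hat W|S}:\ I(S;\hat W)\le R}\mathbb E\big[L_\mu(\hat W)-L_S(\hat W)\big],\qquad \mathcal U_2(R)=\sup_{P_{\hat W|Z}:\ I(\hat W;Z)\le R}\mathbb E\big[L_\mu(\hat W)-\ell(\hat W,Z)\big],$$ the suprema being over Markov kernels for which $L_\mu(\hat W)-\ell(\hat W,Z_i)$, $1\le i\le n$ (respectively $L_\mu(\hat W)-\ell(\hat W,Z)$), is integrable. Let $\tilde\ell:\mathcal W\times\mathcal Z\to\mathbb R$ be another measurable function (the auxiliary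 loss) and let $$v_n=\mathbb E_{S\sim\mu^{\otimes n}}\Big[\inf_{w\in\mathcal W}\frac1n\sum_{i=1}^n\tilde\ell(w,Z_i)\Big]$$ be the average risk of empirical risk minimization under $\tilde\ell$, where the infimum is assumed to be finite for almost every $S$ and integrable. Let $$\tilde{\mathcal U}_2(R)=\sup_{P_{\hat W|\tilde Z}:\ I(\hat W;\tilde Z)\le R,\ \mathbb E[\tilde\ell(\hat W,\tilde Z)]\ge v_n}\mathbb E\big[L_\mu(\hat W)-\ell(\hat W,\tilde Z)\big],$$ the supremum being over Markov kernels for which $L_\mu(\hat W)-\ell(\hat W,\tilde Z)$ is integrable. Fix $R\ge 0$ and assume that the expectation $\mathbb E[\tilde\ell(\hat W,\tilde Z)]$ exists in $[-\infty,\infty]$ for every channel $P_{\hat W|\tilde Z}$ over which the supremum defining $\mathcal U_2(R/n)$ is taken (for example, $\tilde\ell$ is bounded below). Then $$\mathcal U_1(R)\le\tilde{\mathcal U}_2(R/n)\le\mathcal U_2(R/n).$$ -/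

import Mathlib

open MeasureTheory ProbabilityTheory
open scoped ENNReal NNReal

namespace GenBound

noncomputable section

/-- The mutual information `I(X; Y)` (in nats) of the pair `(X, Y)` with `X ∼ P` and
`Y ∼ κ(X)`: the Kullback-Leibler divergence of the joint law from the product of the
marginals. -/
def mutualInfo {X Y : Type*} [MeasurableSpace X] [MeasurableSpace Y]
    (P : Measure X) (κ : Kernel X Y) : ℝ≥0∞ :=
  InformationTheory.klDiv (P ⊗ₘ κ) (P.prod (κ ∘ₘ P))

/-- The expectation of `f` under `P` exists in `[-∞, ∞]`: the positive part or the negative part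
of `f` has finite integral. -/
def HasExpectation {X : Type*} [MeasurableSpace X] (f : X → ℝ) (P : Measure X) : Prop :=
  ∫⁻ x, ENNReal.ofReal (f x) ∂P ≠ ∞ ∨ ∫⁻ x, ENNReal.ofReal (-f x) ∂P ≠ ∞

/-- The expectation of `f` under `P` as an extended real number, positive part minus negative
part; meaningful when `HasExpectation f P`. -/
def expectation {X : Type*} [MeasurableSpace X] (f : X → ℝ) (P : Measure X) : EReal :=
  ((∫⁻ x, ENNReal.ofReal (f x) ∂P : ℝ≥0∞) : EReal) -
    ((∫⁻ x, ENNReal.ofReal (-f x) ∂P : ℝ≥0∞) : EReal)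

variable {Z W : Type*} [MeasurableSpace Z] [MeasurableSpace W]

/-- The law of the training sample `S = (Z₁, …, Zₙ)` of i.i.d. elements with law `μ`. -/
def sampleLaw (μ : Measure Z) (n : ℕ) : Measure (Fin n → Z) :=
  Measure.pi fun _ => μ

/-- The population risk `L_μ(w)`. -/
def populationRisk (ℓ : W → Z → ℝ) (μ : Measure Z) (w : W) : ℝ :=
  ∫ z, ℓ w z ∂μ

/-- The empirical risk `L_s(w)`. -/
def empiricalRisk {n : ℕ} (ℓ : W → Z → ℝ) (s : Fin n → Z) (w : W) : ℝ :=
  (1 / (n : ℝ)) * ∑ i, ℓ w (s i)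

/-- The generalization gap on a sample, `gen_μ(w, s) = L_μ(w) - L_s(w)`. -/
def sampleGap {n : ℕ} (ℓ : W → Z → ℝ) (μ : Measure Z) (w : W) (s : Fin n → Z) : ℝ :=
  populationRisk ℓ μ w - empiricalRisk ℓ s w

/-- The generalization gap on one data point, `gen_μ(w, z) = L_μ(w) - ℓ(w, z)`. -/
def pointGap (ℓ : W → Z → ℝ) (μ : Measure Z) (w : W) (z : Z) : ℝ :=
  populationRisk ℓ μ w - ℓ w z

/-- The risk of empirical risk minimization on the training sample `s`. -/
def ermRisk {n : ℕ} (ℓ : W → Z → ℝ) (s : Fin n → Z) : ℝ :=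
  ⨅ w, empiricalRisk ℓ s w

/-- `v_n`, the average risk of empirical risk minimization on `n` samples. -/
def meanErmRisk (ℓ : W → Z → ℝ) (μ : Measure Z) (n : ℕ) : ℝ :=
  ∫ s, ermRisk ℓ s ∂(sampleLaw μ n)

/-- The learning algorithms over which `U1` takes its supremum: Markov kernels `P_{W|S}` with
`I(S; W) ≤ R`, such that the gap at every sample point, `L_μ(W) - ℓ(W, Z_i)`, has a finite
expectation. -/
def IsAdmissibleAlgorithm (ℓ : W → Z → ℝ) (μ : Measure Z) (n : ℕ) (R : ℝ≥0)
    (κ : Kernel (Fin n → Z) W) : Prop :=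
  IsMarkovKernel κ ∧ mutualInfo (sampleLaw μ n) κ ≤ R ∧
    ∀ i, Integrable (fun p : (Fin n → Z) × W => pointGap ℓ μ p.2 (p.1 i)) (sampleLaw μ n ⊗ₘ κ)

/-- The single-letter channels over which `U2` takes its supremum: Markov kernels `P_{W|Z}` with
`I(W; Z) ≤ R`, such that the gap `L_μ(W) - ℓ(W, Z)` has a finite expectation. -/
def IsAdmissibleChannel (ℓ : W → Z → ℝ) (μ : Measure Z) (R : ℝ≥0) (κ : Kernel Z W) : Prop :=
  IsMarkovKernel κ ∧ mutualInfo μ κ ≤ R ∧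
    Integrable (fun p : Z × W => pointGap ℓ μ p.2 p.1) (μ ⊗ₘ κ)

/-- `U₁(R)`: the largest expected generalization gap of an algorithm on `n` samples with
`I(S; W) ≤ R`. -/
def U1 (ℓ : W → Z → ℝ) (μ : Measure Z) (n : ℕ) (R : ℝ≥0) : EReal :=
  ⨆ (κ : Kernel (Fin n → Z) W) (_ : IsAdmissibleAlgorithm ℓ μ n R κ),
    ((∫ p, sampleGap ℓ μ p.2 p.1 ∂(sampleLaw μ n ⊗ₘ κ) : ℝ) : EReal)

/-- `U₂(R)`: the largest expected generalization gap of a single-letter channel with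
`I(W; Z) ≤ R`. -/
def U2 (ℓ : W → Z → ℝ) (μ : Measure Z) (R : ℝ≥0) : EReal :=
  ⨆ (κ : Kernel Z W) (_ : IsAdmissibleChannel ℓ μ R κ),
    ((∫ p, pointGap ℓ μ p.2 p.1 ∂(μ ⊗ₘ κ) : ℝ) : EReal)

/-- `Ũ₂(R)`: as `U2`, restricted to the channels whose risk under the auxiliary loss `ℓ'` exists
(in `[-∞, ∞]`) and is at least `v_n`, the average ERM risk under `ℓ'` on `n` samples. -/
def U2Aux (ℓ ℓ' : W → Z → ℝ) (μ : Measure Z) (n : ℕ) (R : ℝ≥0) : EReal :=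
  ⨆ (κ : Kernel Z W) (_ : IsAdmissibleChannel ℓ μ R κ ∧
      HasExpectation (fun p : Z × W => ℓ' p.2 p.1) (μ ⊗ₘ κ) ∧
      ((meanErmRisk ℓ' μ n : ℝ) : EReal) ≤ expectation (fun p : Z × W => ℓ' p.2 p.1) (μ ⊗ₘ κ)),
    ((∫ p, pointGap ℓ μ p.2 p.1 ∂(μ ⊗ₘ κ) : ℝ) : EReal)

end

end GenBound

namespace GenBound

/-! ### Kullback-Leibler divergence: Gibbs, convexity, superadditivity. -/

open InformationTheory

/-! An algorithm on `n` points becomes a single-letter channel by planting the datum at a uniformly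
random position of an otherwise fresh sample (`pooledChannel`). The joint law of datum and output is
then the average over `i` of the laws of `(Z_i, W)` (`compProd_pooledChannel`), so expectations of
functions of the pair are expectations of sample averages. Hence the gap is preserved, and the
auxiliary risk is an expected empirical risk, which pointwise is at least the ERM risk: the
constraint holds.

The output marginal is unchanged, so convexity of the divergence and superadditivity over
independent coordinates give `I(Z; W) ≤ (1/n) ∑ I(Z_i; W) ≤ I(S; W) / n`. The second inequality of
the theorem only drops a constraint. -/

lemma mul_log_sub_add_one_le_klFun {x y : ℝ} (hx : 0 ≤ x) (hy : 0 ≤ y) (h : y = 0 → x = 0) :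
    x * Real.log y - y + 1 ≤ klFun x := by
  rcases hx.eq_or_lt with rfl | hx
  · simp [klFun]; exact hy
  -- `h` excludes the default value `Real.log 0 = 0`, for which the bound can fail.
  have hy : 0 < y := lt_of_le_of_ne hy fun h0 => hx.ne' (h h0.symm)
  have := Real.log_le_sub_one_of_pos (div_pos hy hx)
  rw [Real.log_div hy.ne' hx.ne'] at this
  have h2 := mul_le_mul_of_nonneg_left this hx.le
  have h3 : x * (y / x - 1) = y - x := by field_simp
  rw [klFun]
  linarith

/-- **Gibbs' variational inequality**. -/
lemma integral_log_le_toReal_klDiv {α : Type*} [MeasurableSpace α] {P Q : Measure α}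
    [IsProbabilityMeasure P] [IsProbabilityMeasure Q] (hPQ : klDiv P Q ≠ ∞) {g : α → ℝ}
    (hg : 0 ≤ g) (hg_int : Integrable g Q) (hg_le : ∫ x, g x ∂Q ≤ 1) (hg_pos : ∀ᵐ x ∂P, g x ≠ 0)
    (hlog : Integrable (fun x => Real.log (g x)) P) :
    ∫ x, Real.log (g x) ∂P ≤ (klDiv P Q).toReal := by
  obtain ⟨hac, hllr⟩ := klDiv_ne_top_iff.1 hPQ
  rw [toReal_klDiv_eq_integral_klFun hac, ← integral_rnDeriv_smul hac]
  have h1 : Integrable (fun x => (P.rnDeriv Q x).toReal • Real.log (g x)) Q :=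
    (integrable_rnDeriv_smul_iff hac).2 hlog
  have h2 : ∀ᵐ x ∂Q, g x = 0 → (P.rnDeriv Q x).toReal = 0 := by
    have h3 : ∀ᵐ x ∂(Q.withDensity (P.rnDeriv Q)), g x ≠ 0 := by
      rwa [Measure.withDensity_rnDeriv_eq _ _ hac]
    rw [ae_withDensity_iff (by fun_prop)] at h3
    filter_upwards [h3] with x hx hx0
    by_contra h
    exact hx (fun h' => h (by simp [h'])) hx0
  have h4 := (integrable_klFun_rnDeriv_iff hac).2 hllr
  have h6 : Integrable (fun x => (P.rnDeriv Q x).toReal • Real.log (g x) - g x) Q := h1.sub hg_int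
  -- After integration the terms `-g + 1` contribute `1 - ∫ g ≥ 0`, which can be dropped.
  have h5 : ∫ x, ((P.rnDeriv Q x).toReal • Real.log (g x) - g x + 1) ∂Q
      ≤ ∫ x, klFun (P.rnDeriv Q x).toReal ∂Q := by
    refine integral_mono_ae ((h1.sub hg_int).add (integrable_const _)) h4 ?_
    filter_upwards [h2] with x hx
    exact mul_log_sub_add_one_le_klFun ENNReal.toReal_nonneg (hg x) hx
  rw [integral_add h6 (integrable_const _), integral_sub h1 hg_int] at h5
  simp only [integral_const, probReal_univ, smul_eq_mul, one_mul] at h5 ⊢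
  linarith

/-- The Kullback-Leibler divergence is convex in its first argument. -/
lemma klDiv_average_le {α ι : Type*} [MeasurableSpace α] [Fintype ι] [Nonempty ι]
    (P : ι → Measure α) (Q : Measure α) [∀ i, IsFiniteMeasure (P i)] [IsFiniteMeasure Q] :
    klDiv ((Fintype.card ι : ℝ≥0∞)⁻¹ • ∑ i, P i) Q
      ≤ (Fintype.card ι : ℝ≥0∞)⁻¹ * ∑ i, klDiv (P i) Q := by
  set c : ℝ≥0∞ := (Fintype.card ι : ℝ≥0∞)⁻¹ with hc
  have hc0 : c ≠ 0 := by simp [hc]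
  have hcT : c ≠ ∞ := by simp [hc]
  by_cases hfin : ∀ i, klDiv (P i) Q ≠ ∞
  swap
  · push Not at hfin
    obtain ⟨i, hi⟩ := hfin
    have : ∑ i, klDiv (P i) Q = ∞ := ENNReal.sum_eq_top.2 ⟨i, Finset.mem_univ _, hi⟩
    rw [this, ENNReal.mul_top hc0]
    exact le_top
  have hac : ∀ i, P i ≪ Q := fun i => (klDiv_ne_top_iff.1 (hfin i)).1
  have havg : c • ∑ i, P i = Q.withDensity (fun x => c * ∑ i, (P i).rnDeriv Q x) := by
    ext s hs
    rw [withDensity_apply _ hs, lintegral_const_mul _ (by fun_prop),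
      lintegral_finsetSum _ (fun _ _ => by fun_prop)]
    simp [Measure.finsetSum_apply, Measure.setLIntegral_rnDeriv (hac _)]
  have hacA : c • ∑ i, P i ≪ Q := havg ▸ withDensity_absolutelyContinuous _ _
  have : IsFiniteMeasure (c • ∑ i, P i) := by
    refine ⟨?_⟩
    simp only [Measure.smul_apply, Measure.finsetSum_apply, smul_eq_mul]
    exact ENNReal.mul_lt_top hcT.lt_top (ENNReal.sum_lt_top.2 fun i _ => measure_lt_top _ _)
  rw [klDiv_eq_lintegral_klFun_of_ac hacA]
  simp_rw [klDiv_eq_lintegral_klFun_of_ac (hac _)]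
  rw [← lintegral_finsetSum _ (fun _ _ => by fun_prop), ← lintegral_const_mul _ (by fun_prop)]
  refine lintegral_mono_ae ?_
  have h1 : (c • ∑ i, P i).rnDeriv Q =ᵐ[Q] fun x => c * ∑ i, (P i).rnDeriv Q x := by
    rw [havg]
    exact Measure.rnDeriv_withDensity _ (by fun_prop)
  have h2 : ∀ᵐ x ∂Q, ∀ i, (P i).rnDeriv Q x ≠ ∞ :=
    ae_all_iff.2 fun i => Measure.rnDeriv_ne_top _ _
  filter_upwards [h1, h2] with x hx hxT
  rw [hx, ENNReal.toReal_mul, ENNReal.toReal_sum (fun i _ => hxT i), Finset.mul_sum]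
  have hcs : ∑ _i : ι, c.toReal = 1 := by simp [hc]
  -- Jensen with equal weights, pointwise in the densities.
  have h3 := convexOn_klFun.map_sum_le (t := Finset.univ) (w := fun _ : ι => c.toReal)
    (p := fun i => ((P i).rnDeriv Q x).toReal) (fun _ _ => ENNReal.toReal_nonneg) hcs
    (fun _ _ => ENNReal.toReal_nonneg)
  simp only [smul_eq_mul] at h3
  refine (ENNReal.ofReal_le_ofReal h3).trans_eq ?_
  rw [ENNReal.ofReal_sum_of_nonneg fun i _ =>
    mul_nonneg ENNReal.toReal_nonneg (klFun_nonneg ENNReal.toReal_nonneg), Finset.mul_sum]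
  refine Finset.sum_congr rfl fun i _ => ?_
  rw [ENNReal.ofReal_mul ENNReal.toReal_nonneg, ENNReal.ofReal_toReal hcT]

/-- If a probability measure on `Z × W` with second marginal `ν` has a density with respect to
`μ.prod ν`, then almost every section of the density has integral one. -/
lemma lintegral_rnDeriv_section_eq_one {Z W : Type*} [MeasurableSpace Z] [MeasurableSpace W]
    {μ : Measure Z} [IsProbabilityMeasure μ] {ν : Measure W} [IsProbabilityMeasure ν]
    {P : Measure (Z × W)} [IsProbabilityMeasure P] (hP : P.snd = ν) (hac : P ≪ μ.prod ν) :
    ∀ᵐ w ∂ν, ∫⁻ z, P.rnDeriv (μ.prod ν) (z, w) ∂μ = 1 := by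
  have hm : Measurable fun p : Z × W => P.rnDeriv (μ.prod ν) p := by fun_prop
  have hm' : Measurable fun w => ∫⁻ z, P.rnDeriv (μ.prod ν) (z, w) ∂μ := hm.lintegral_prod_left'
  -- Over any `s`, both sides integrate to `P (Z × s) = ν s`.
  refine ae_eq_of_forall_setLIntegral_eq_of_sigmaFinite hm' measurable_const ?_
  intro s hs _
  have h1 : P (Prod.snd ⁻¹' s) = ν s := by rw [← hP, Measure.snd_apply hs]
  have h2 := Measure.setLIntegral_rnDeriv hac (Prod.snd ⁻¹' s)
  have h3 : (Prod.snd ⁻¹' s : Set (Z × W)) = Set.univ ×ˢ s := by ext; simp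
  rw [h1, h3, ← Measure.prod_restrict, Measure.restrict_univ, lintegral_prod_symm' _ hm] at h2
  rw [h2]
  simp

lemma ae_rnDeriv_toReal_ne_zero {α : Type*} [MeasurableSpace α] {P Q : Measure α}
    [IsFiniteMeasure P] [IsFiniteMeasure Q] (hac : P ≪ Q) :
    ∀ᵐ x ∂P, (P.rnDeriv Q x).toReal ≠ 0 := by
  filter_upwards [Measure.rnDeriv_pos hac, hac.ae_le (Measure.rnDeriv_ne_top P Q)] with x h1 h2
  exact (ENNReal.toReal_pos h1.ne' h2).ne'

/-- Superadditivity of the mutual information over independent coordinates. -/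
lemma sum_klDiv_map_eval_le {ι Z W : Type*} [Fintype ι] [MeasurableSpace Z] [MeasurableSpace W]
    {μ : Measure Z} [IsProbabilityMeasure μ] {ν : Measure W} [IsProbabilityMeasure ν]
    {P : Measure ((ι → Z) × W)} [IsProbabilityMeasure P] (hP : P.snd = ν) :
    ∑ i, klDiv (P.map fun p => (p.1 i, p.2)) (μ.prod ν)
      ≤ klDiv P ((Measure.pi fun _ : ι => μ).prod ν) := by
  by_cases hfin : klDiv P ((Measure.pi fun _ : ι => μ).prod ν) = ∞
  · rw [hfin]; exact le_top
  have he : ∀ i, Measurable fun p : (ι → Z) × W => (p.1 i, p.2) := fun i => by fun_prop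
  have hprob : ∀ i, IsProbabilityMeasure (P.map fun p => (p.1 i, p.2)) := fun i =>
    Measure.isProbabilityMeasure_map (he i).aemeasurable
  have hQ : ∀ i, ((Measure.pi fun _ : ι => μ).prod ν).map (fun p => (p.1 i, p.2)) = μ.prod ν := by
    intro i
    exact ((measurePreserving_eval (fun _ : ι => μ) i).prod (MeasurePreserving.id ν)).map_eq
  -- Data processing: finiteness passes to each pair, making its log-likelihood ratio integrable.
  have hle : ∀ i, klDiv (P.map fun p => (p.1 i, p.2)) (μ.prod ν) ≠ ∞ := by
    intro i
    refine ne_top_of_le_ne_top hfin ?_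
    rw [← hQ i]
    exact klDiv_map_le _ _ (he i)
  have hac := fun i => (klDiv_ne_top_iff.1 (hle i)).1
  have hllr := fun i => (klDiv_ne_top_iff.1 (hle i)).2
  set f : ι → Z × W → ℝ := fun i q =>
    ((P.map fun p => (p.1 i, p.2)).rnDeriv (μ.prod ν) q).toReal with hf
  have hfm : ∀ i, Measurable (f i) := fun i => by fun_prop
  have hsec : ∀ᵐ w ∂ν, ∀ i, Integrable (fun z => f i (z, w)) μ ∧ ∫ z, f i (z, w) ∂μ = 1 := by
    refine ae_all_iff.2 fun i => ?_
    have hs : (P.map fun p : (ι → Z) × W => (p.1 i, p.2)).snd = ν := by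
      rw [← hP, Measure.snd, Measure.map_map measurable_snd (he i)]; rfl
    filter_upwards [lintegral_rnDeriv_section_eq_one hs (hac i)] with w hw
    have hm : Measurable fun z =>
      (P.map fun p : (ι → Z) × W => (p.1 i, p.2)).rnDeriv (μ.prod ν) (z, w) :=
      (Measure.measurable_rnDeriv _ _).comp measurable_prodMk_right
    refine ⟨integrable_toReal_of_lintegral_ne_top hm.aemeasurable (by simp [hw]), ?_⟩
    rw [integral_toReal hm.aemeasurable (ae_lt_top hm (by simp [hw])), hw, ENNReal.toReal_one]
  -- Test function for Gibbs: the density of the law that keeps each pair `(Z_i, W)` but makes the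
  -- coordinates independent given `W`. Its sections integrate to one by Fubini, and `log g` splits
  -- into the log-likelihood ratios of the pairs.
  set g : (ι → Z) × W → ℝ := fun p => ∏ i, f i (p.1 i, p.2) with hg
  have hg0 : 0 ≤ g := fun p => Finset.prod_nonneg fun i _ => ENNReal.toReal_nonneg
  have hgm : Measurable g := by fun_prop
  have hgsec : ∀ᵐ w ∂ν, Integrable (fun s => g (s, w)) (Measure.pi fun _ : ι => μ) ∧
      ∫ s, g (s, w) ∂(Measure.pi fun _ : ι => μ) = 1 := by
    filter_upwards [hsec] with w hw
    refine ⟨Integrable.fintype_prod fun i => (hw i).1, ?_⟩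
    rw [hg]
    simp only
    rw [integral_fintype_prod_eq_prod (fun i z => f i (z, w))]
    simp [fun i => (hw i).2]
  have hgint : Integrable g ((Measure.pi fun _ : ι => μ).prod ν) := by
    rw [integrable_prod_iff' hgm.aestronglyMeasurable]
    refine ⟨hgsec.mono fun w hw => hw.1, ?_⟩
    refine (integrable_const (1 : ℝ)).congr ?_
    filter_upwards [hgsec] with w hw
    simp_rw [Real.norm_of_nonneg (hg0 _)]
    exact hw.2.symm
  have hgone : ∫ p, g p ∂((Measure.pi fun _ : ι => μ).prod ν) = 1 := by
    rw [integral_prod_symm _ hgint, integral_congr_ae (hgsec.mono fun w hw => hw.2)]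
    simp
  have hpos : ∀ᵐ p ∂P, ∀ i, f i (p.1 i, p.2) ≠ 0 := ae_all_iff.2 fun i =>
    ae_of_ae_map (he i).aemeasurable (ae_rnDeriv_toReal_ne_zero (hac i))
  have hlogeq : (fun p => ∑ i, Real.log (f i (p.1 i, p.2))) =ᵐ[P] fun p => Real.log (g p) := by
    filter_upwards [hpos] with p hp
    exact (Real.log_prod fun i _ => hp i).symm
  have hlogi : ∀ i, Integrable (fun p : (ι → Z) × W => Real.log (f i (p.1 i, p.2))) P := fun i =>
    (hllr i).comp_measurable (he i)
  have key := integral_log_le_toReal_klDiv hfin hg0 hgint hgone.le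
    (hpos.mono fun p hp => Finset.prod_ne_zero_iff.2 fun i _ => hp i)
    ((integrable_finsetSum _ fun i _ => hlogi i).congr hlogeq)
  rw [← integral_congr_ae hlogeq, integral_finsetSum _ fun i _ => hlogi i] at key
  have hkl : ∀ i, (klDiv (P.map fun p => (p.1 i, p.2)) (μ.prod ν)).toReal
      = ∫ p, Real.log (f i (p.1 i, p.2)) ∂P := by
    intro i
    rw [toReal_klDiv_of_measure_eq (hac i) (by simp)]
    exact integral_map (he i).aemeasurable (hllr i).aestronglyMeasurable
  simp_rw [← hkl] at key
  rw [← ENNReal.toReal_sum fun i _ => hle i] at key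
  exact (ENNReal.toReal_le_toReal (ENNReal.sum_ne_top.2 fun i _ => hle i) hfin).1 key

/-! ### Channels built from an algorithm. -/

instance {Z : Type*} [MeasurableSpace Z] (μ : Measure Z) [IsProbabilityMeasure μ] (n : ℕ) :
    IsProbabilityMeasure (sampleLaw μ n) := by
  unfold sampleLaw; infer_instance

lemma measurePreserving_update {ι Z : Type*} [Fintype ι] [DecidableEq ι] [MeasurableSpace Z]
    (μ : Measure Z) [IsProbabilityMeasure μ] (i : ι) :
    MeasurePreserving (fun p : Z × (ι → Z) => Function.update p.2 i p.1)
      (μ.prod (Measure.pi fun _ => μ)) (Measure.pi fun _ => μ) := by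
  have hm : Measurable fun p : Z × (ι → Z) => Function.update p.2 i p.1 := by
    refine measurable_pi_lambda _ fun j => ?_
    by_cases h : j = i
    · subst h; simpa using measurable_fst
    · simp only [Function.update_of_ne h]; fun_prop
  refine ⟨hm, (Measure.pi_eq fun s hs => ?_).symm⟩
  rw [Measure.map_apply hm (MeasurableSet.univ_pi hs)]
  have : (fun p : Z × (ι → Z) => Function.update p.2 i p.1) ⁻¹' (Set.univ.pi s)
      = s i ×ˢ Set.univ.pi (Function.update s i Set.univ) := by
    ext p
    simp only [Set.mem_preimage, Set.mem_pi, Set.mem_univ, true_implies, Set.mem_prod]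
    constructor
    · intro h
      refine ⟨by simpa using h i, fun j => ?_⟩
      by_cases hj : j = i
      · subst hj; simp
      · simpa [hj] using h j
    · rintro ⟨h0, h⟩ j
      by_cases hj : j = i
      · subst hj; simpa using h0
      · simpa [hj] using h j
  rw [this, Measure.prod_prod, Measure.pi_pi, ← Finset.mul_prod_erase _ _ (Finset.mem_univ i),
    ← Finset.mul_prod_erase _ (fun j => μ (s j)) (Finset.mem_univ i)]
  simp only [Function.update_self, measure_univ, one_mul]
  congr 1
  refine Finset.prod_congr rfl fun j hj => ?_
  rw [Function.update_of_ne (Finset.ne_of_mem_erase hj)]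

variable {Z W : Type*} [MeasurableSpace Z] [MeasurableSpace W]

/-- The conditional law of the output of the algorithm `κ` given the `i`-th sample point: the
other points are integrated out. -/
noncomputable def coordChannel (μ : Measure Z) [IsProbabilityMeasure μ] {n : ℕ}
    (κ : Kernel (Fin n → Z) W) (i : Fin n) : Kernel Z W :=
  (κ.comap _ (measurePreserving_update μ i).measurable) ∘ₖ
    (Kernel.id ×ₖ Kernel.const Z (sampleLaw μ n))

lemma coordChannel_apply (μ : Measure Z) [IsProbabilityMeasure μ] {n : ℕ}
    (κ : Kernel (Fin n → Z) W) (i : Fin n) (z : Z) {t : Set W} (ht : MeasurableSet t) :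
    coordChannel μ κ i z t = ∫⁻ s, κ (Function.update s i z) t ∂(sampleLaw μ n) := by
  rw [coordChannel, Kernel.comp_apply' _ _ _ ht, Kernel.prod_apply, lintegral_prod]
  · simp only [Kernel.id_apply, Kernel.const_apply, Kernel.comap_apply]
    rw [lintegral_dirac']
    refine Measurable.lintegral_prod_right' (f := fun p : Z × (Fin n → Z) =>
      κ (Function.update p.2 i p.1) t) ?_
    exact (κ.measurable_coe ht).comp (measurePreserving_update μ i).measurable
  · exact ((κ.measurable_coe ht).comp (measurePreserving_update μ i).measurable).aemeasurable

instance (μ : Measure Z) [IsProbabilityMeasure μ] {n : ℕ} (κ : Kernel (Fin n → Z) W)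
    [IsMarkovKernel κ] (i : Fin n) : IsMarkovKernel (coordChannel μ κ i) := by
  unfold coordChannel; infer_instance

/-- Overwriting a coordinate with an independent draw preserves the sample law. This gives the
conditional law given `Z_i` explicitly, with no disintegration and hence no topological assumption.
-/
lemma compProd_coordChannel (μ : Measure Z) [IsProbabilityMeasure μ] {n : ℕ}
    (κ : Kernel (Fin n → Z) W) [IsMarkovKernel κ] (i : Fin n) :
    μ ⊗ₘ coordChannel μ κ i = (sampleLaw μ n ⊗ₘ κ).map fun p => (p.1 i, p.2) := by
  have he : Measurable fun p : (Fin n → Z) × W => (p.1 i, p.2) := by fun_prop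
  ext t ht
  have hm : Measurable fun s : Fin n → Z => κ s (Prod.mk (s i) ⁻¹' t) :=
    Kernel.measurable_kernel_prodMk_left (he ht)
  rw [Measure.map_apply he ht, Measure.compProd_apply ht, Measure.compProd_apply (he ht)]
  have h := (measurePreserving_update μ i).lintegral_comp hm
  have hm' := hm.comp (measurePreserving_update μ i).measurable
  simp only [Function.comp_def] at hm'
  rw [lintegral_prod _ hm'.aemeasurable] at h
  refine Eq.trans ?_ h
  refine lintegral_congr fun z => ?_
  rw [coordChannel_apply _ _ _ _ (measurable_prodMk_left ht)]
  simp [sampleLaw]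

/-- The channel that feeds `z` to the algorithm `κ` at a uniformly random position of the sample,
the other points being drawn independently. -/
noncomputable def pooledChannel (μ : Measure Z) [IsProbabilityMeasure μ] {n : ℕ}
    (κ : Kernel (Fin n → Z) W) : Kernel Z W where
  toFun z := (n : ℝ≥0∞)⁻¹ • ∑ i, coordChannel μ κ i z
  measurable' := by
    refine Measure.measurable_of_measurable_coe _ fun t ht => ?_
    simp only [Measure.smul_apply, Measure.finsetSum_apply, smul_eq_mul]
    exact (Finset.measurable_fun_sum _ fun i _ => (coordChannel μ κ i).measurable_coe ht).const_mul _

lemma pooledChannel_apply (μ : Measure Z) [IsProbabilityMeasure μ] {n : ℕ}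
    (κ : Kernel (Fin n → Z) W) (z : Z) :
    pooledChannel μ κ z = (n : ℝ≥0∞)⁻¹ • ∑ i, coordChannel μ κ i z := rfl

lemma isMarkovKernel_pooledChannel (μ : Measure Z) [IsProbabilityMeasure μ] {n : ℕ} (hn : 0 < n)
    (κ : Kernel (Fin n → Z) W) [IsMarkovKernel κ] : IsMarkovKernel (pooledChannel μ κ) := by
  refine ⟨fun z => ⟨?_⟩⟩
  simp only [pooledChannel_apply, Measure.smul_apply, Measure.finsetSum_apply, measure_univ,
    Finset.sum_const, Finset.card_univ, Fintype.card_fin, smul_eq_mul, nsmul_eq_mul, mul_one]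
  exact ENNReal.inv_mul_cancel (by simpa using hn.ne') (by simp)

lemma compProd_pooledChannel (μ : Measure Z) [IsProbabilityMeasure μ] {n : ℕ} (hn : 0 < n)
    (κ : Kernel (Fin n → Z) W) [IsMarkovKernel κ] :
    μ ⊗ₘ pooledChannel μ κ
      = (n : ℝ≥0∞)⁻¹ • ∑ i, (sampleLaw μ n ⊗ₘ κ).map fun p => (p.1 i, p.2) := by
  have := isMarkovKernel_pooledChannel μ hn κ
  simp_rw [← compProd_coordChannel]
  ext t ht
  simp only [Measure.smul_apply, Measure.finsetSum_apply, smul_eq_mul, Measure.compProd_apply ht,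
    pooledChannel_apply]
  have hm : ∀ i, Measurable fun z => coordChannel μ κ i z (Prod.mk z ⁻¹' t) := fun i =>
    Kernel.measurable_kernel_prodMk_left ht
  rw [lintegral_const_mul _ (Finset.measurable_fun_sum _ fun i _ => hm i),
    lintegral_finsetSum _ fun i _ => hm i]

/-- All pairs `(Z_i, W)` share the second marginal, so averaging leaves it alone. The divergences
thus have a common reference measure, as convexity in the first argument requires. -/
lemma comp_pooledChannel (μ : Measure Z) [IsProbabilityMeasure μ] {n : ℕ} (hn : 0 < n)
    (κ : Kernel (Fin n → Z) W) [IsMarkovKernel κ] :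
    pooledChannel μ κ ∘ₘ μ = κ ∘ₘ sampleLaw μ n := by
  have := isMarkovKernel_pooledChannel μ hn κ
  rw [← Measure.snd_compProd, ← Measure.snd_compProd, compProd_pooledChannel μ hn]
  ext t ht
  have he : ∀ i, Measurable fun p : (Fin n → Z) × W => (p.1 i, p.2) := fun i => by fun_prop
  simp only [Measure.snd_apply ht, Measure.smul_apply, Measure.finsetSum_apply, smul_eq_mul,
    Measure.map_apply (he _) (measurable_snd ht)]
  have h : ∀ i : Fin n, (fun p : (Fin n → Z) × W => (p.1 i, p.2)) ⁻¹' (Prod.snd ⁻¹' t)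
      = Prod.snd ⁻¹' t := fun i => rfl
  simp only [h, Finset.sum_const, Finset.card_univ, Fintype.card_fin, nsmul_eq_mul]
  rw [← mul_assoc, ENNReal.inv_mul_cancel (by simpa using hn.ne') (by simp), one_mul]

lemma mutualInfo_pooledChannel_le (μ : Measure Z) [IsProbabilityMeasure μ] {n : ℕ} (hn : 0 < n)
    (κ : Kernel (Fin n → Z) W) [IsMarkovKernel κ] :
    mutualInfo μ (pooledChannel μ κ) ≤ (n : ℝ≥0∞)⁻¹ * mutualInfo (sampleLaw μ n) κ := by
  have : Nonempty (Fin n) := ⟨⟨0, hn⟩⟩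
  rw [mutualInfo, compProd_pooledChannel μ hn, comp_pooledChannel μ hn]
  have h1 := klDiv_average_le (fun i : Fin n => (sampleLaw μ n ⊗ₘ κ).map fun p => (p.1 i, p.2))
    (μ.prod (κ ∘ₘ sampleLaw μ n))
  rw [Fintype.card_fin] at h1
  refine h1.trans (mul_le_mul_right ?_ _)
  exact sum_klDiv_map_eval_le (Measure.snd_compProd _ _)

lemma lintegral_compProd_pooledChannel (μ : Measure Z) [IsProbabilityMeasure μ] {n : ℕ}
    (hn : 0 < n) (κ : Kernel (Fin n → Z) W) [IsMarkovKernel κ] {φ : Z × W → ℝ≥0∞}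
    (hφ : Measurable φ) :
    ∫⁻ q, φ q ∂(μ ⊗ₘ pooledChannel μ κ)
      = (n : ℝ≥0∞)⁻¹ * ∑ i, ∫⁻ p, φ (p.1 i, p.2) ∂(sampleLaw μ n ⊗ₘ κ) := by
  rw [compProd_pooledChannel μ hn, lintegral_smul_measure, lintegral_finsetSum_measure]
  simp only [smul_eq_mul]
  congr 1
  exact Finset.sum_congr rfl fun i _ => lintegral_map hφ (by fun_prop)

lemma integrable_compProd_pooledChannel_iff (μ : Measure Z) [IsProbabilityMeasure μ] {n : ℕ}
    (hn : 0 < n) (κ : Kernel (Fin n → Z) W) [IsMarkovKernel κ] {φ : Z × W → ℝ}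
    (hφ : Measurable φ) :
    Integrable φ (μ ⊗ₘ pooledChannel μ κ)
      ↔ ∀ i, Integrable (fun p => φ (p.1 i, p.2)) (sampleLaw μ n ⊗ₘ κ) := by
  rw [compProd_pooledChannel μ hn, integrable_smul_measure (by simp) (by simpa using hn.ne'),
    integrable_finsetSum_measure]
  simp only [Finset.mem_univ, true_implies]
  exact forall_congr' fun i => integrable_map_measure hφ.aestronglyMeasurable (by fun_prop)

lemma integral_compProd_pooledChannel (μ : Measure Z) [IsProbabilityMeasure μ] {n : ℕ}
    (hn : 0 < n) (κ : Kernel (Fin n → Z) W) [IsMarkovKernel κ] {φ : Z × W → ℝ}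
    (hφ : Measurable φ)
    (hi : ∀ i, Integrable (fun p => φ (p.1 i, p.2)) (sampleLaw μ n ⊗ₘ κ)) :
    ∫ q, φ q ∂(μ ⊗ₘ pooledChannel μ κ)
      = ∫ p, (1 / (n : ℝ)) * ∑ i, φ (p.1 i, p.2) ∂(sampleLaw μ n ⊗ₘ κ) := by
  have he : ∀ i, AEMeasurable (fun p : (Fin n → Z) × W => (p.1 i, p.2)) (sampleLaw μ n ⊗ₘ κ) :=
    fun i => by fun_prop
  rw [compProd_pooledChannel μ hn, integral_smul_measure, integral_finsetSum_measure
    fun i _ => (integrable_map_measure hφ.aestronglyMeasurable (he i)).2 (hi i),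
    integral_const_mul, integral_finsetSum _ fun i _ => hi i]
  simp only [ENNReal.toReal_inv, ENNReal.toReal_natCast, smul_eq_mul, one_div]
  congr 1
  exact Finset.sum_congr rfl fun i _ => integral_map (he i) hφ.aestronglyMeasurable

/-! ### Extended expectations and the auxiliary risk constraint. -/

lemma expectation_eq_integral {X : Type*} [MeasurableSpace X] {f : X → ℝ} {P : Measure X}
    (hf : Integrable f P) : expectation f P = ((∫ x, f x ∂P : ℝ) : EReal) := by
  have h1 : ∫⁻ x, ENNReal.ofReal (f x) ∂P ≠ ∞ := hf.lintegral_lt_top.ne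
  have h2 : ∫⁻ x, ENNReal.ofReal (-f x) ∂P ≠ ∞ := hf.neg.lintegral_lt_top.ne
  rw [expectation, integral_eq_lintegral_pos_part_sub_lintegral_neg_part hf, EReal.coe_sub,
    EReal.coe_ennreal_toReal h1, EReal.coe_ennreal_toReal h2]

lemma expectation_eq_top {X : Type*} [MeasurableSpace X] {f : X → ℝ} {P : Measure X}
    (hf : HasExpectation f P) (htop : ∫⁻ x, ENNReal.ofReal (f x) ∂P = ∞) :
    expectation f P = ⊤ := by
  have h : ∫⁻ x, ENNReal.ofReal (-f x) ∂P ≠ ∞ := hf.resolve_left (not_not.2 htop)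
  rw [expectation, htop]
  lift ∫⁻ x, ENNReal.ofReal (-f x) ∂P to ℝ≥0 using h with c
  exact EReal.top_sub_coe c

lemma integrable_posPart_of_lintegral_ne_top {X : Type*} [MeasurableSpace X] {f : X → ℝ}
    {P : Measure X} (hf : Measurable f) (h : ∫⁻ x, ENNReal.ofReal (f x) ∂P ≠ ∞) :
    Integrable (fun x => max (f x) 0) P := by
  refine (lintegral_ofReal_ne_top_iff_integrable (by fun_prop)
    (Filter.Eventually.of_forall fun x => le_max_right _ _)).1 ?_
  convert h using 3 with x
  simp

/-- The pooled channel has auxiliary risk at least the mean risk of empirical risk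
minimization. -/
lemma meanErmRisk_le_expectation_pooledChannel {μ : Measure Z} [IsProbabilityMeasure μ]
    {ℓ : W → Z → ℝ} (hℓ : Measurable (fun p : W × Z => ℓ p.1 p.2)) {n : ℕ} (hn : 0 < n)
    (hbdd : ∀ᵐ s ∂(sampleLaw μ n), BddBelow (Set.range fun w => empiricalRisk ℓ s w))
    (herm : Integrable (fun s : Fin n → Z => ermRisk ℓ s) (sampleLaw μ n))
    (κ : Kernel (Fin n → Z) W) [IsMarkovKernel κ]
    (hexp : HasExpectation (fun p : Z × W => ℓ p.2 p.1) (μ ⊗ₘ pooledChannel μ κ)) :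
    ((meanErmRisk ℓ μ n : ℝ) : EReal)
      ≤ expectation (fun p : Z × W => ℓ p.2 p.1) (μ ⊗ₘ pooledChannel μ κ) := by
  set P := sampleLaw μ n ⊗ₘ κ with hP
  have hφ : Measurable fun q : Z × W => ℓ q.2 q.1 := hℓ.comp measurable_swap
  have ha : ∀ i, Measurable fun p : (Fin n → Z) × W => ℓ p.2 (p.1 i) := fun i =>
    hφ.comp (g := fun q : Z × W => ℓ q.2 q.1) (f := fun p : (Fin n → Z) × W => (p.1 i, p.2))
      (by fun_prop)
  by_cases htop : ∫⁻ q, ENNReal.ofReal (ℓ q.2 q.1) ∂(μ ⊗ₘ pooledChannel μ κ) = ∞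
  · rw [expectation_eq_top hexp htop]
    exact le_top
  have hn' : (0 : ℝ) < n := by exact_mod_cast hn
  have hpos : ∀ i, Integrable (fun p : (Fin n → Z) × W => max (ℓ p.2 (p.1 i)) 0) P := by
    intro i
    refine integrable_posPart_of_lintegral_ne_top (ha i) ?_
    rw [lintegral_compProd_pooledChannel μ hn κ (φ := fun q => ENNReal.ofReal (ℓ q.2 q.1))
      hφ.ennreal_ofReal] at htop
    have hsum : ∑ i, ∫⁻ p, ENNReal.ofReal (ℓ p.2 (p.1 i)) ∂P ≠ ∞ := fun h =>
      htop (by rw [h]; exact ENNReal.mul_top (by simp))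
    exact ENNReal.sum_ne_top.1 hsum i (Finset.mem_univ i)
  have hfst : P.map Prod.fst = sampleLaw μ n := Measure.fst_compProd _ _
  have hermP : Integrable (fun p : (Fin n → Z) × W => ermRisk ℓ p.1) P :=
    (hfst ▸ herm).comp_measurable measurable_fst
  have hle : ∀ᵐ p ∂P, ermRisk ℓ p.1 ≤ (1 / (n : ℝ)) * ∑ i, ℓ p.2 (p.1 i) := by
    -- A real `⨅` over a family unbounded below is `0`, so boundedness is needed for it to be a
    -- lower bound.
    have hb : ∀ᵐ p ∂P, BddBelow (Set.range fun w => empiricalRisk ℓ p.1 w) :=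
      ae_of_ae_map measurable_fst.aemeasurable (hfst.symm ▸ hbdd)
    filter_upwards [hb] with p hp using ciInf_le hp p.2
  -- Positive parts are integrable. Below, the sum of the losses is at least `n` times the ERM risk,
  -- so one loss can be very negative only if the others' positive parts or the ERM risk are large
  -- in absolute value.
  have hint : ∀ i, Integrable (fun p : (Fin n → Z) × W => ℓ p.2 (p.1 i)) P := by
    intro i
    refine ((integrable_finsetSum Finset.univ fun j _ => hpos j).add
      (hermP.norm.const_mul (n : ℝ))).mono' (ha i).aestronglyMeasurable ?_
    filter_upwards [hle] with p hp
    rw [one_div, inv_mul_eq_div, le_div_iff₀ hn', mul_comm] at hp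
    have h1 : ∑ j, ℓ p.2 (p.1 j) ≤ ℓ p.2 (p.1 i) + ∑ j, max (ℓ p.2 (p.1 j)) 0 := by
      rw [← Finset.add_sum_erase _ (fun j => ℓ p.2 (p.1 j)) (Finset.mem_univ i)]
      gcongr
      refine (Finset.sum_le_sum fun j _ => le_max_left (ℓ p.2 (p.1 j)) 0).trans ?_
      exact Finset.sum_le_sum_of_subset_of_nonneg (Finset.erase_subset _ _)
        fun _ _ _ => le_max_right _ _
    have h2 : ℓ p.2 (p.1 i) ≤ ∑ j, max (ℓ p.2 (p.1 j)) 0 :=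
      (le_max_left _ 0).trans (Finset.single_le_sum
        (f := fun j => max (ℓ p.2 (p.1 j)) 0) (fun _ _ => le_max_right _ _) (Finset.mem_univ i))
    have h3 : -((n : ℝ) * ‖ermRisk ℓ p.1‖) ≤ n * ermRisk ℓ p.1 := by
      rw [← mul_neg]
      exact mul_le_mul_of_nonneg_left (neg_abs_le _) hn'.le
    have h4 : 0 ≤ (n : ℝ) * ‖ermRisk ℓ p.1‖ := by positivity
    simp only [Pi.add_apply]
    rw [Real.norm_eq_abs, abs_le]
    constructor <;> linarith
  rw [expectation_eq_integral
      ((integrable_compProd_pooledChannel_iff μ hn κ (φ := fun q => ℓ q.2 q.1) hφ).2 hint),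
    EReal.coe_le_coe_iff,
    integral_compProd_pooledChannel μ hn κ (φ := fun q => ℓ q.2 q.1) hφ hint]
  have hmean : meanErmRisk ℓ μ n = ∫ p, ermRisk ℓ p.1 ∂P := by
    rw [meanErmRisk, ← hfst,
      integral_map measurable_fst.aemeasurable (hfst ▸ herm.aestronglyMeasurable)]
  rw [hmean]
  exact integral_mono_ae hermP
    ((integrable_finsetSum Finset.univ fun j _ => hint j).const_mul _) hle

/-! ### Generalization gap and admissibility of the pooled channel. -/

lemma measurable_pointGap {μ : Measure Z} [IsProbabilityMeasure μ] {ℓ : W → Z → ℝ}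
    (hℓ : Measurable (fun p : W × Z => ℓ p.1 p.2)) :
    Measurable fun q : Z × W => pointGap ℓ μ q.2 q.1 := by
  have h : Measurable (populationRisk ℓ μ) :=
    (hℓ.stronglyMeasurable.integral_prod_right (f := ℓ)).measurable
  exact (h.comp measurable_snd).sub (hℓ.comp measurable_swap)

omit [MeasurableSpace W] in
lemma sampleGap_eq_average_pointGap (ℓ : W → Z → ℝ) (μ : Measure Z) {n : ℕ} (hn : 0 < n) (w : W)
    (s : Fin n → Z) : sampleGap ℓ μ w s = (1 / (n : ℝ)) * ∑ i, pointGap ℓ μ w (s i) := by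
  have hn' : (n : ℝ) ≠ 0 := by exact_mod_cast hn.ne'
  simp only [sampleGap, pointGap, empiricalRisk, Finset.sum_sub_distrib, Finset.sum_const,
    Finset.card_univ, Fintype.card_fin, nsmul_eq_mul]
  field_simp

lemma isAdmissibleChannel_pooledChannel {μ : Measure Z} [IsProbabilityMeasure μ] {ℓ : W → Z → ℝ}
    (hℓ : Measurable (fun p : W × Z => ℓ p.1 p.2)) {n : ℕ} (hn : 0 < n) {R : ℝ≥0}
    {κ : Kernel (Fin n → Z) W} (hκ : IsAdmissibleAlgorithm ℓ μ n R κ) :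
    IsAdmissibleChannel ℓ μ (R / n) (pooledChannel μ κ) := by
  obtain ⟨hM, hI, hint⟩ := hκ
  refine ⟨isMarkovKernel_pooledChannel μ hn κ, ?_,
    (integrable_compProd_pooledChannel_iff μ hn κ (measurable_pointGap hℓ)).2 hint⟩
  refine (mutualInfo_pooledChannel_le μ hn κ).trans ?_
  rw [ENNReal.coe_div (by exact_mod_cast hn.ne'), ENNReal.coe_natCast, ENNReal.div_eq_inv_mul]
  gcongr


end GenBound

theorem mainTheorem12 {Z W : Type*} [MeasurableSpace Z] [MeasurableSpace W]
    (μ : Measure Z) [IsProbabilityMeasure μ]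
    -- the loss
    (ℓ : W → Z → ℝ) (hℓ : Measurable (fun p : W × Z => ℓ p.1 p.2))
    (hℓ_int : ∀ w, Integrable (ℓ w) μ)
    -- the auxiliary loss
    (ℓ' : W → Z → ℝ) (hℓ' : Measurable (fun p : W × Z => ℓ' p.1 p.2))
    (n : ℕ) (hn : 0 < n) (R : ℝ≥0)
    -- `v_n` is well defined and finite
    (hbdd : ∀ᵐ s ∂(GenBound.sampleLaw μ n),
      BddBelow (Set.range fun w => GenBound.empiricalRisk ℓ' s w))
    (herm : Integrable (fun s : Fin n → Z => GenBound.ermRisk ℓ' s) (GenBound.sampleLaw μ n))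
    -- the auxiliary risk that the constraint is about exists in `[-∞, ∞]`
    (hrisk : ∀ κ : Kernel Z W, GenBound.IsAdmissibleChannel ℓ μ (R / n) κ →
      GenBound.HasExpectation (fun p : Z × W => ℓ' p.2 p.1) (μ ⊗ₘ κ)) :
    GenBound.U1 ℓ μ n R ≤ GenBound.U2Aux ℓ ℓ' μ n (R / n) ∧
      GenBound.U2Aux ℓ ℓ' μ n (R / n) ≤ GenBound.U2 ℓ μ (R / n) := by

  constructor
  · refine iSup₂_le fun κ hκ => ?_
    have hM := hκ.1
    have hadm := GenBound.isAdmissibleChannel_pooledChannel hℓ hn hκ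
    have hexp := hrisk _ hadm
    refine le_iSup₂_of_le (GenBound.pooledChannel μ κ) ⟨hadm, hexp,
      GenBound.meanErmRisk_le_expectation_pooledChannel hℓ' hn hbdd herm κ hexp⟩ ?_
    rw [GenBound.integral_compProd_pooledChannel μ hn κ (GenBound.measurable_pointGap hℓ) hκ.2.2]
    simp_rw [GenBound.sampleGap_eq_average_pointGap ℓ μ hn]
    exact le_rfl
  · exact iSup₂_le fun κ hκ => le_iSup₂_of_le κ hκ.1 le_rfl
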